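/- Let $P$ be a finite poset with $n$ elements and let $G$ be its incomparability graph, i.e. the graph with vertex set $P$ in which two elements are adjacent if and only if they are incomparable in $P$. Let $X_G=\sum_{\kappa}\prod_{v\in P}x_{\kappa(v)}$ be the chromatic symmetric function of $G$, where the sum is over all proper colorings $\kappa$ of $G$ by positive integers. It has a unique expansion $X_G=\sum_\lambda c_\lambda s_\lambda$ in the basis of Schur functions, with integer coefficients of which finitely many are nonzero. For a partition $\lambda$, a $P$-tableau of shape $\lambda$ is a filling $(a_{i,j})$ of the cells of the diagram of $\lambda$ (row $i$, column $j$, with row $1$ the longest row) with the elements of $P$, each used exactly once, such that $a_{i,j}<_P a_{i,j+1}$ and $a_{i+1,j}\not<_P a_{i,j}$ whenever these cells belong to the diagram. Then for every $1\le k\le n$ the hook coefficient $c_{\lambda^{(k)}}$, where $\lambda^{(k)}=(k,1,\dots,1)$ is the hook partition of $n$ with first part $k$, equals the number of $P$-tableaux of shape $\lambda^{(k)}$. (No assumption that $G$ is claw-free is made.) -/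

import Mathlib

/-- The incomparability graph of a poset: two elements are adjacent iff neither is `≤` the other. -/
def incomparabilityGraph (P : Type*) [PartialOrder P] : SimpleGraph P where
  Adj x y := ¬ x ≤ y ∧ ¬ y ≤ x
  symm := ⟨fun _ _ h => ⟨h.2, h.1⟩⟩
  loopless := ⟨fun _ h => h.1 le_rfl⟩

/-- The chromatic symmetric function of a finite graph, as a formal power series in the variables
`x_0, x_1, x_2, …`: the coefficient of a monomial `x ^ d` is the number of proper colourings `κ` by
natural numbers with `∏ v, x_(κ v) = x ^ d`. There are finitely many of these. -/
noncomputable def chromaticSymmetricFunction {V : Type*} [Fintype V] (G : SimpleGraph V) :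
    MvPowerSeries ℕ ℤ :=
  fun d => (Nat.card {κ : G.Coloring ℕ // ∑ v, Finsupp.single (κ v) 1 = d} : ℤ)

/-- The weight of a semistandard Young tableau: the exponent vector that records how often each
number occurs among its entries. -/
noncomputable def SemistandardYoungTableau.weight {μ : YoungDiagram}
    (T : SemistandardYoungTableau μ) : ℕ →₀ ℕ :=
  ∑ c ∈ μ.cells, Finsupp.single (T c.1 c.2) 1

/-- The Schur function of shape `μ`, as a formal power series in the variables `x_0, x_1, x_2, …`:
the coefficient of `x ^ d` is the number of semistandard tableaux of shape `μ` and weight `d`.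
There are finitely many of these. -/
noncomputable def schurFunction (μ : YoungDiagram) : MvPowerSeries ℕ ℤ :=
  fun d => (Nat.card {T : SemistandardYoungTableau μ // T.weight = d} : ℤ)

/-- `c` is a family of coefficients of an expansion `f = ∑ μ, c μ • s_μ` of `f` in Schur functions
(with finitely many nonzero coefficients). -/
def IsSchurExpansion (f : MvPowerSeries ℕ ℤ) (c : YoungDiagram →₀ ℤ) : Prop :=
  f = c.sum fun μ a => a • schurFunction μ

/-- The hook `(k, 1, …, 1)` with `m` parts `1` after the first part `k ≥ 1`. -/
def hookShape (k m : ℕ) (hk : 1 ≤ k) : YoungDiagram :=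
  YoungDiagram.ofRowLens (k :: List.replicate m 1) (by
    refine List.Pairwise.sortedGE (List.pairwise_cons.2 ⟨fun a ha => ?_, ?_⟩)
    · rw [List.eq_of_mem_replicate ha]; exact hk
    · exact List.pairwise_replicate.2 (Or.inr le_rfl))

/-- A `P`-tableau of shape `μ`: a filling of the cells of `μ` with the elements of the poset `P`,
each used exactly once, such that each row is strictly increasing from left to right and an entry
of a column is never smaller in `P` than the entry of the preceding row. A cell `(i, j)` is in
row `i` and column `j`, and row `0` is the longest row. -/
structure PTableau (P : Type*) [PartialOrder P] (μ : YoungDiagram) where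
  entry : {c : ℕ × ℕ // c ∈ μ} ≃ P
  row_lt : ∀ (i j : ℕ) (h : (i, j) ∈ μ) (h' : (i, j + 1) ∈ μ),
    entry ⟨(i, j), h⟩ < entry ⟨(i, j + 1), h'⟩
  col_not_lt : ∀ (i j : ℕ) (h : (i, j) ∈ μ) (h' : (i + 1, j) ∈ μ),
    ¬ entry ⟨(i + 1, j), h'⟩ < entry ⟨(i, j), h⟩

/-! ### Words increasing on blocks, and colourings by chains -/

/-- The word `w` is `r`-increasing on each set of positions on which `γ` is constant. -/
def IsBlockWord {V : Type*} (r : V → V → Prop) {n : ℕ} (γ : Fin n → ℕ) (w : Fin n ≃ V) : Prop :=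
  ∀ p q, p < q → γ p = γ q → r (w p) (w q)

/-- The permutation `w'.symm ∘ w` is strictly increasing: across blocks because colours agree,
within a block because both words list it in the order r. Such a permutation of `Fin n` is the
identity. -/
theorem IsBlockWord.eq_of_colour_eq {V : Type*} {r : V → V → Prop} (hirr : ∀ v, ¬ r v v)
    (htr : ∀ u v w, r u v → r v w → r u w) {n : ℕ} {γ : Fin n → ℕ} (hγ : Monotone γ)
    {w w' : Fin n ≃ V} (hw : IsBlockWord r γ w) (hw' : IsBlockWord r γ w')
    (h : ∀ v, γ (w.symm v) = γ (w'.symm v)) : w = w' := by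
  have key : StrictMono fun p => w'.symm (w p) := by
    intro p q hpq
    have hp := h (w p)
    have hq := h (w q)
    simp only [Equiv.symm_apply_apply] at hp hq
    rcases lt_trichotomy (w'.symm (w p)) (w'.symm (w q)) with h1 | h1 | h1
    · exact h1
    · exact absurd (w.injective (w'.symm.injective h1)) hpq.ne
    · have h2 : γ p = γ q := le_antisymm (hγ hpq.le) (by rw [hp, hq]; exact hγ h1.le)
      have h3 := hw' _ _ h1 (by rw [← hp, ← hq, h2])
      simp only [Equiv.apply_symm_apply] at h3
      exact absurd (htr _ _ _ h3 (hw p q hpq h2)) (hirr _)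
  have h2 : (fun p => w'.symm (w p)) = id := by
    refine (key.range_inj strictMono_id).1 ?_
    rw [Set.range_id]
    exact (w.trans w'.symm).surjective.range_eq
  ext p
  have := congrFun h2 p
  simpa [Equiv.symm_apply_eq] using this

theorem sum_single_one_toMultiset {V : Type*} [Fintype V] (κ : V → ℕ) :
    Finsupp.toMultiset (∑ v, Finsupp.single (κ v) 1) = Finset.univ.val.map κ := by
  simp only [map_sum, Finsupp.toMultiset_single, one_smul]
  exact (congrArg Multiset.sum (Multiset.map_map _ _ _)).symm.trans (Multiset.sum_map_singleton _)

theorem card_eq_of_weight_eq {V W : Type*} [Fintype V] [Fintype W] {κ : V → ℕ} {γ : W → ℕ}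
    (h : ∑ v, Finsupp.single (κ v) 1 = ∑ p, Finsupp.single (γ p) 1) :
    Fintype.card V = Fintype.card W := by
  have := congrArg (fun d => (Finsupp.toMultiset d).card) h
  simpa [sum_single_one_toMultiset, Finset.card_univ] using this

theorem eq_of_monotone_of_weight_eq {n : ℕ} {f g : Fin n → ℕ} (hf : Monotone f) (hg : Monotone g)
    (h : ∑ p, Finsupp.single (f p) 1 = ∑ p, Finsupp.single (g p) 1) : f = g := by
  have := congrArg Finsupp.toMultiset h
  rw [sum_single_one_toMultiset, sum_single_one_toMultiset, Fin.univ_val_map, Fin.univ_val_map,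
    Multiset.coe_eq_coe] at this
  exact List.ofFn_injective
    (this.eq_of_sortedLE (List.sortedLE_ofFn_iff.2 hf) (List.sortedLE_ofFn_iff.2 hg))

/-- List V by colour and, within a colour, by r; this is a linear order because each colour class is
a chain. -/
theorem exists_isBlockWord {V : Type*} [Fintype V] {r : V → V → Prop} (hirr : ∀ v, ¬ r v v)
    (htr : ∀ u v w, r u v → r v w → r u w) {n : ℕ} {γ : Fin n → ℕ} (hγ : Monotone γ)
    {κ : V → ℕ} (hκ : ∀ u v, u ≠ v → κ u = κ v → r u v ∨ r v u)
    (h : ∑ v, Finsupp.single (κ v) 1 = ∑ p, Finsupp.single (γ p) 1) :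
    ∃ w : Fin n ≃ V, IsBlockWord r γ w ∧ ∀ p, κ (w p) = γ p := by
  classical
  have hcard : Fintype.card V = n := by simpa using card_eq_of_weight_eq h
  let lt : V → V → Prop := fun u v => κ u < κ v ∨ (κ u = κ v ∧ r u v)
  have : IsStrictTotalOrder V lt :=
    { trichotomous := fun u v h1 h2 => by
        by_contra hne
        simp only [lt, not_or, not_and, not_lt] at h1 h2
        have he := le_antisymm h2.1 h1.1
        rcases hκ u v hne he with h3 | h3
        exacts [h1.2 he h3, h2.2 he.symm h3]
      irrefl := fun u h1 => by
        rcases h1 with h1 | h1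
        exacts [lt_irrefl _ h1, hirr _ h1.2]
      trans := fun u v w h1 h2 => by
        rcases h1 with h1 | h1 <;> rcases h2 with h2 | h2
        · exact Or.inl (h1.trans h2)
        · exact Or.inl (h2.1 ▸ h1)
        · exact Or.inl (h1.1 ▸ h2)
        · exact Or.inr ⟨h1.1.trans h2.1, htr _ _ _ h1.2 h2.2⟩ }
  let : LinearOrder V := linearOrderOfSTO lt
  let w : Fin n ≃o V := monoEquivOfFin V hcard
  have hlt : ∀ p q, p < q → lt (w p) (w q) := fun p q hpq => w.strictMono hpq
  have hw : (fun p => κ (w p)) = γ := by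
    refine eq_of_monotone_of_weight_eq ?_ hγ ?_
    · intro p q hpq
      rcases hpq.eq_or_lt with rfl | hpq
      · exact le_rfl
      · rcases hlt p q hpq with h1 | h1
        exacts [h1.le, h1.1.le]
    · rw [← h]
      exact Equiv.sum_comp w.toEquiv fun v => Finsupp.single (κ v) 1
  refine ⟨w.toEquiv, fun p q hpq he => ?_, fun p => congrFun hw p⟩
  rcases hlt p q hpq with h1 | h1
  · have hp := congrFun hw p
    have hq := congrFun hw q
    omega
  · exact h1.2

/-! ### Cuts and inclusion–exclusion -/

/-- The colour of position `p` when the positions are cut in front of each element of `S`. -/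
def cutColour (S : Finset ℕ) {n : ℕ} (p : Fin n) : ℕ := (S.filter (· ≤ (p : ℕ))).card

theorem cutColour_monotone (S : Finset ℕ) (n : ℕ) : Monotone (cutColour S (n := n)) := by
  intro p q hpq
  refine Finset.card_le_card fun s hs => ?_
  rw [Finset.mem_filter] at hs ⊢
  exact ⟨hs.1, hs.2.trans hpq⟩

theorem isBlockWord_cutColour_iff {V : Type*} {r : V → V → Prop}
    (htr : ∀ u v w, r u v → r v w → r u w) {n : ℕ} (S : Finset ℕ) (w : Fin n ≃ V) :
    IsBlockWord r (cutColour S) w ↔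
      ∀ (p : ℕ) (hp : p + 1 < n), p + 1 ∉ S → r (w ⟨p, by omega⟩) (w ⟨p + 1, hp⟩) := by
  constructor
  · intro h p hp hS
    refine h _ _ (Fin.mk_lt_mk.2 (Nat.lt_succ_self p)) ?_
    unfold cutColour
    congr 1
    refine Finset.filter_congr fun s hs => ?_
    have : s ≠ p + 1 := fun h => hS (h ▸ hs)
    simp only
    omega
  · intro h
    have key : ∀ (d p : ℕ) (hq : p + d + 1 < n),
        cutColour S (⟨p, by omega⟩ : Fin n) = cutColour S (⟨p + d + 1, hq⟩ : Fin n) →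
        r (w ⟨p, by omega⟩) (w ⟨p + d + 1, hq⟩) := by
      intro d
      induction d with
      | zero =>
        intro p hq he
        refine h p hq fun hS => ?_
        -- A cut at `p + 1` is counted by the colour of `p + 1` but not by that of `p`.
        refine (Finset.card_lt_card (Finset.ssubset_iff_of_subset ?_ |>.2 ⟨p + 1, ?_, ?_⟩)).ne he
        · intro s hs
          rw [Finset.mem_filter] at hs ⊢
          exact ⟨hs.1, by have := hs.2; simp only at this ⊢; omega⟩
        · simpa using hS
        · simp
      | succ d ih =>
        intro p hq he
        have h1 := cutColour_monotone S n
          (show (⟨p, by omega⟩ : Fin n) ≤ ⟨p + d + 1, by omega⟩ from Fin.mk_le_mk.2 (by omega))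
        have h2 := cutColour_monotone S n
          (show (⟨p + d + 1, by omega⟩ : Fin n) ≤ ⟨p + d + 1 + 1, by omega⟩ from
            Fin.mk_le_mk.2 (by omega))
        have he' : cutColour S (⟨p, by omega⟩ : Fin n) =
          cutColour S (⟨p + d + 1 + 1, by omega⟩ : Fin n) := he
        have h3 := ih p (by omega) (by omega)
        refine htr _ _ _ h3 (h (p + d + 1) (by omega) fun hS => ?_)
        refine absurd (show cutColour S (⟨p + d + 1, by omega⟩ : Fin n) =
          cutColour S (⟨p + d + 1 + 1, by omega⟩ : Fin n) by omega)
          (Finset.card_lt_card (Finset.ssubset_iff_of_subset ?_ |>.2 ⟨p + d + 1 + 1, ?_, ?_⟩)).ne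
        · intro s hs
          rw [Finset.mem_filter] at hs ⊢
          exact ⟨hs.1, by have := hs.2; simp only at this ⊢; omega⟩
        · simpa using hS
        · simp
    rintro ⟨p, hp⟩ ⟨q, hq⟩ hpq he
    obtain ⟨d, rfl⟩ : ∃ d, q = p + d + 1 := ⟨q - p - 1, by have := Fin.mk_lt_mk.1 hpq; omega⟩
    exact key d p hq he

/-- The word `w` fails to be `r`-increasing exactly at the positions in `[1, m]`. -/
def IsHookWord {V : Type*} (r : V → V → Prop) {n : ℕ} (m : ℕ) (w : Fin n ≃ V) : Prop :=
  ∀ (p : ℕ) (hp : p + 1 < n), r (w ⟨p, by omega⟩) (w ⟨p + 1, hp⟩) ↔ m ≤ p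

/-- Complementation in A turns the sum into the signed sum over all subsets of `A \ D`, which
vanishes unless this set is empty. -/
theorem Finset.sum_powerset_superset_neg_one_pow {α : Type*} [DecidableEq α] (A D : Finset α)
    (hD : D ⊆ A) :
    ∑ S ∈ A.powerset, (if D ⊆ S then (-1 : ℤ) ^ (A.card - S.card) else 0) =
      if D = A then 1 else 0 := by
  rw [← Finset.sum_filter]
  have h1 : ∑ S ∈ A.powerset.filter (D ⊆ ·), (-1 : ℤ) ^ (A.card - S.card) =
      ∑ S ∈ (A \ D).powerset, (-1 : ℤ) ^ S.card := by
    refine Finset.sum_bij' (fun S _ => A \ S) (fun S _ => A \ S) ?_ ?_ ?_ ?_ ?_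
    · intro S hS
      simp only [Finset.mem_filter, Finset.mem_powerset] at hS ⊢
      exact Finset.sdiff_subset_sdiff le_rfl hS.2
    · intro S hS
      simp only [Finset.mem_filter, Finset.mem_powerset] at hS ⊢
      refine ⟨Finset.sdiff_subset, fun x hx => ?_⟩
      exact Finset.mem_sdiff.2 ⟨hD hx, fun h => (Finset.mem_sdiff.1 (hS h)).2 hx⟩
    · intro S hS
      simp only [Finset.mem_filter, Finset.mem_powerset] at hS
      exact Finset.sdiff_sdiff_eq_self hS.1
    · intro S hS
      simp only [Finset.mem_powerset] at hS
      exact Finset.sdiff_sdiff_eq_self (hS.trans Finset.sdiff_subset)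
    · intro S hS
      simp only [Finset.mem_filter, Finset.mem_powerset] at hS
      rw [Finset.card_sdiff_of_subset hS.1]
  rw [h1, Finset.sum_powerset_neg_one_pow_card]
  simp only [Finset.sdiff_eq_empty_iff_subset]
  congr 1
  exact propext ⟨fun h => Finset.Subset.antisymm hD h, fun h => h ▸ le_rfl⟩

/-- Inclusion–exclusion over the sets of cuts. -/
theorem sum_neg_one_pow_card_blockWords {V : Type*} [Finite V] {r : V → V → Prop}
    (htr : ∀ u v w, r u v → r v w → r u w) {n m : ℕ} (hm : m < n) (Q : (Fin n ≃ V) → Prop) :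
    ∑ S ∈ (Finset.Icc 1 m).powerset, (-1 : ℤ) ^ (m - S.card) *
        (Nat.card {w : Fin n ≃ V // IsBlockWord r (cutColour S) w ∧ Q w} : ℤ) =
      Nat.card {w : Fin n ≃ V // IsHookWord r m w ∧ Q w} := by
  classical
  have := Fintype.ofFinite V
  -- `D w` is the set of cuts in `[1, m]` that w forces; `B w` says that w increases from position m
  -- on, where no cut is available.
  let D : (Fin n ≃ V) → Finset ℕ := fun w => (Finset.Icc 1 m).filter fun s =>
    ∃ h : s < n, ¬ r (w ⟨s - 1, by omega⟩) (w ⟨s, h⟩)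
  let B : (Fin n ≃ V) → Prop := fun w =>
    ∀ (p : ℕ) (hp : p + 1 < n), m ≤ p → r (w ⟨p, by omega⟩) (w ⟨p + 1, hp⟩)
  have hblock : ∀ S ∈ (Finset.Icc 1 m).powerset, ∀ w : Fin n ≃ V,
      IsBlockWord r (cutColour S) w ↔ B w ∧ D w ⊆ S := by
    intro S hS w
    rw [Finset.mem_powerset] at hS
    rw [isBlockWord_cutColour_iff htr]
    constructor
    · intro h
      refine ⟨fun p hp hmp => h p hp fun hpS => ?_, fun s hs => ?_⟩
      · have := Finset.mem_Icc.1 (hS hpS)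
        omega
      · obtain ⟨h1, h2, h3⟩ := Finset.mem_filter.1 hs
        rw [Finset.mem_Icc] at h1
        obtain ⟨s, rfl⟩ : ∃ t, s = t + 1 := ⟨s - 1, by omega⟩
        by_contra hsS
        exact h3 (h s h2 hsS)
    · rintro ⟨h1, h2⟩ p hp hpS
      by_cases hmp : m ≤ p
      · exact h1 p hp hmp
      · by_contra h3
        exact hpS (h2 (Finset.mem_filter.2 ⟨Finset.mem_Icc.2 ⟨by omega, by omega⟩, hp, h3⟩))
  have hhook : ∀ w : Fin n ≃ V, IsHookWord r m w ↔ B w ∧ D w = Finset.Icc 1 m := by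
    intro w
    constructor
    · intro h
      refine ⟨fun p hp hmp => (h p hp).2 hmp, Finset.filter_true_of_mem fun s hs => ?_⟩
      rw [Finset.mem_Icc] at hs
      obtain ⟨s, rfl⟩ : ∃ t, s = t + 1 := ⟨s - 1, by omega⟩
      refine ⟨by omega, fun h3 => ?_⟩
      have := (h s (by omega)).1 h3
      omega
    · rintro ⟨h1, h2⟩ p hp
      refine ⟨fun h3 => ?_, h1 p hp⟩
      by_contra hmp
      have h4 : p + 1 ∈ D w := h2 ▸ Finset.mem_Icc.2 ⟨by omega, by omega⟩
      exact (Finset.mem_filter.1 h4).2.2 h3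
  have hcard : ∀ R : (Fin n ≃ V) → Prop,
      (Nat.card {w : Fin n ≃ V // R w ∧ Q w} : ℤ) =
        ∑ w ∈ Finset.univ.filter Q, if R w then 1 else 0 := by
    intro R
    rw [Nat.card_eq_fintype_card, Fintype.card_subtype, ← Finset.sum_filter, Finset.sum_const,
      Finset.filter_filter]
    simp [and_comm]
  simp_rw [hcard, Finset.mul_sum]
  rw [Finset.sum_comm]
  refine Finset.sum_congr rfl fun w _ => ?_
  have h1 : ∀ S ∈ (Finset.Icc 1 m).powerset,
      (-1 : ℤ) ^ (m - S.card) * (if IsBlockWord r (cutColour S) w then 1 else 0) =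
        (if B w then 1 else 0) *
          (if D w ⊆ S then (-1 : ℤ) ^ ((Finset.Icc 1 m).card - S.card) else 0) := by
    intro S hS
    simp only [hblock S hS w, Nat.card_Icc, Nat.add_sub_cancel]
    by_cases hB : B w <;> by_cases hDS : D w ⊆ S <;> simp [hB, hDS]
  rw [Finset.sum_congr rfl h1, ← Finset.mul_sum,
    Finset.sum_powerset_superset_neg_one_pow _ _ (Finset.filter_subset _ _)]
  simp only [hhook]
  by_cases hB : B w <;> simp [hB, D]

/-! ### The Bender–Knuth involution on row counts -/

namespace SemistandardYoungTableau

variable {μ : YoungDiagram}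

theorem exists_not_mem_and_lt (T : SemistandardYoungTableau μ) (r v : ℕ) :
    ∃ j, ¬ ((r, j) ∈ μ ∧ T r j < v) := by
  obtain ⟨j, hj⟩ := YoungDiagram.exists_notMem_row μ r
  exact ⟨j, fun h => hj h.1⟩

open Classical in
/-- The number of entries less than `v` in row `r`. -/
noncomputable def rowCount (T : SemistandardYoungTableau μ) (r v : ℕ) : ℕ :=
  Nat.find (T.exists_not_mem_and_lt r v)

theorem lt_rowCount_iff (T : SemistandardYoungTableau μ) {r v j : ℕ} :
    j < T.rowCount r v ↔ (r, j) ∈ μ ∧ T r j < v := by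
  classical
  rw [rowCount, Nat.lt_find_iff]
  constructor
  · intro h
    exact not_not.1 (h j le_rfl)
  · intro h j' hj'
    exact not_not.2 ⟨μ.up_left_mem le_rfl hj' h.1, (T.row_weak_of_le hj' h.1).trans_lt h.2⟩

theorem ext_rowCount {T T' : SemistandardYoungTableau μ}
    (h : ∀ r v, T.rowCount r v = T'.rowCount r v) : T = T' := by
  ext r j
  by_cases hc : (r, j) ∈ μ
  · have key : ∀ v, T r j < v ↔ T' r j < v := by
      intro v
      have h1 := T.lt_rowCount_iff (r := r) (v := v) (j := j)
      have h2 := T'.lt_rowCount_iff (r := r) (v := v) (j := j)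
      rw [h] at h1
      simp only [hc, true_and] at h1 h2
      exact h1.symm.trans h2
    exact le_antisymm (Nat.lt_succ_iff.1 ((key _).2 (Nat.lt_succ_self _)))
      (Nat.lt_succ_iff.1 ((key _).1 (Nat.lt_succ_self _)))
  · rw [T.zeros hc, T'.zeros hc]

theorem rowCount_mono (T : SemistandardYoungTableau μ) (r : ℕ) {v v' : ℕ} (h : v ≤ v') :
    T.rowCount r v ≤ T.rowCount r v' := by
  by_contra! hlt
  have h1 := T.lt_rowCount_iff.1 hlt
  exact lt_irrefl _ (T.lt_rowCount_iff.2 ⟨h1.1, h1.2.trans_le h⟩)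

/-- Columns are strict, so an entry below `v + 1` lies under one below `v`. With `rowCount_mono`
these are the interlacing inequalities of a Gelfand–Tsetlin pattern. -/
theorem rowCount_succ_le (T : SemistandardYoungTableau μ) (r v : ℕ) :
    T.rowCount (r + 1) (v + 1) ≤ T.rowCount r v := by
  by_contra! hlt
  have h1 := T.lt_rowCount_iff.1 hlt
  have h2 := T.col_strict (Nat.lt_add_one r) h1.1
  exact lt_irrefl _ (T.lt_rowCount_iff.2 ⟨μ.up_left_mem (Nat.le_add_right r 1) le_rfl h1.1, by omega⟩)

theorem rowCount_eq_zero (T : SemistandardYoungTableau μ) {r : ℕ} (hr : μ.colLen 0 ≤ r) (v : ℕ) :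
    T.rowCount r v = 0 := by
  by_contra h
  have h1 := (T.lt_rowCount_iff.1 (Nat.pos_of_ne_zero h)).1
  rw [YoungDiagram.mem_iff_lt_colLen] at h1
  omega

theorem card_filter_lt (T : SemistandardYoungTableau μ) (v : ℕ) :
    (μ.cells.filter fun c => T c.1 c.2 < v).card =
      ∑ r ∈ Finset.range (μ.colLen 0), T.rowCount r v := by
  rw [Finset.card_eq_sum_card_fiberwise (f := Prod.fst) (t := Finset.range (μ.colLen 0))]
  · refine Finset.sum_congr rfl fun r _ => ?_
    rw [← Finset.card_range (T.rowCount r v)]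
    refine Finset.card_bij' (fun c _ => c.2) (fun j _ => (r, j)) ?_ ?_ ?_ ?_
    · rintro ⟨a, b⟩ hc
      simp only [Finset.mem_filter, YoungDiagram.mem_cells] at hc
      obtain ⟨hc, rfl⟩ := hc
      exact Finset.mem_range.2 (T.lt_rowCount_iff.2 hc)
    · intro j hj
      have := T.lt_rowCount_iff.1 (Finset.mem_range.1 hj)
      simpa using this
    · rintro ⟨a, b⟩ hc
      simp only [Finset.mem_filter] at hc
      obtain ⟨hc, rfl⟩ := hc
      rfl
    · intro j hj
      rfl
  · rintro ⟨a, b⟩ hc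
    simp only [Finset.coe_filter, YoungDiagram.mem_cells, Set.mem_ofPred_eq] at hc
    have := μ.up_left_mem le_rfl (Nat.zero_le b) hc.1
    simpa using YoungDiagram.mem_iff_lt_colLen.1 this

theorem weight_apply (T : SemistandardYoungTableau μ) (v : ℕ) :
    T.weight v = (μ.cells.filter fun c => T c.1 c.2 = v).card := by
  rw [weight, Finsupp.finsetSum_apply, Finset.card_filter]
  exact Finset.sum_congr rfl fun c _ => Finsupp.single_apply

theorem weight_add_sum_rowCount (T : SemistandardYoungTableau μ) (v : ℕ) :
    T.weight v + ∑ r ∈ Finset.range (μ.colLen 0), T.rowCount r v =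
      ∑ r ∈ Finset.range (μ.colLen 0), T.rowCount r (v + 1) := by
  rw [← card_filter_lt, ← card_filter_lt, weight_apply, ← Finset.card_union_of_disjoint]
  · congr 1
    ext c
    simp only [Finset.mem_union, Finset.mem_filter, ← and_or_left]
    refine and_congr_right fun _ => ?_
    omega
  · refine Finset.disjoint_filter.2 fun c _ h1 => ?_
    omega

/-- The least possible number of entries less than `i + 1` in row `r` of a tableau that agrees with
`T` away from the entries `i` and `i + 1`. -/
noncomputable def rowCountMin (T : SemistandardYoungTableau μ) (i r : ℕ) : ℕ :=
  max (T.rowCount r i) (T.rowCount (r + 1) (i + 2))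

/-- The largest possible number of entries less than `i + 1` in row `r` of a tableau that agrees
with `T` away from the entries `i` and `i + 1`. -/
noncomputable def rowCountMax (T : SemistandardYoungTableau μ) (i : ℕ) : ℕ → ℕ
  | 0 => T.rowCount 0 (i + 2)
  | r + 1 => min (T.rowCount (r + 1) (i + 2)) (T.rowCount r i)

theorem rowCountMin_le (T : SemistandardYoungTableau μ) (i r : ℕ) :
    T.rowCountMin i r ≤ T.rowCount r (i + 1) :=
  max_le (T.rowCount_mono r (Nat.le_succ i)) (T.rowCount_succ_le r (i + 1))

theorem le_rowCountMax (T : SemistandardYoungTableau μ) (i r : ℕ) :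
    T.rowCount r (i + 1) ≤ T.rowCountMax i r := by
  cases r with
  | zero => exact T.rowCount_mono 0 (Nat.le_succ (i + 1))
  | succ r => exact le_min (T.rowCount_mono _ (Nat.le_succ (i + 1))) (T.rowCount_succ_le r i)

theorem rowCountMax_le (T : SemistandardYoungTableau μ) (i r : ℕ) :
    T.rowCountMax i r ≤ T.rowCount r (i + 2) := by
  cases r with
  | zero => exact le_rfl
  | succ r => exact min_le_left _ _

/-- The reflected number of entries less than `i + 1` in row `r`. -/
noncomputable def rowCountReflect (T : SemistandardYoungTableau μ) (i r : ℕ) : ℕ :=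
  T.rowCountMin i r + T.rowCountMax i r - T.rowCount r (i + 1)

theorem rowCountMin_le_reflect (T : SemistandardYoungTableau μ) (i r : ℕ) :
    T.rowCountMin i r ≤ T.rowCountReflect i r := by
  have := T.le_rowCountMax i r
  unfold rowCountReflect
  omega

theorem rowCountReflect_le_max (T : SemistandardYoungTableau μ) (i r : ℕ) :
    T.rowCountReflect i r ≤ T.rowCountMax i r := by
  have := T.rowCountMin_le i r
  unfold rowCountReflect
  omega

/-- The lower bound for row r and the upper bound for row r + 1 are the max and the min of the same
two numbers, so the sum of all bounds telescopes. -/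
theorem sum_rowCountReflect (T : SemistandardYoungTableau μ) (i : ℕ) :
    ∑ r ∈ Finset.range (μ.colLen 0), T.rowCountReflect i r +
        ∑ r ∈ Finset.range (μ.colLen 0), T.rowCount r (i + 1) =
      ∑ r ∈ Finset.range (μ.colLen 0), T.rowCount r i +
        ∑ r ∈ Finset.range (μ.colLen 0), T.rowCount r (i + 2) := by
  -- The extra terms are the upper bound of row N, not yet paired with a lower bound, and its first
  -- argument; both vanish once N passes the last row.
  have key : ∀ N, ∑ r ∈ Finset.range N, (T.rowCountMin i r + T.rowCountMax i r) +
      T.rowCountMax i N = ∑ r ∈ Finset.range N, (T.rowCount r i + T.rowCount r (i + 2)) +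
      T.rowCount N (i + 2) := by
    intro N
    induction N with
    | zero => simp [rowCountMax]
    | succ N ih =>
      have h := max_add_min (T.rowCount N i) (T.rowCount (N + 1) (i + 2))
      rw [min_comm] at h
      rw [Finset.sum_range_succ, Finset.sum_range_succ]
      change _ + min _ _ = _
      rw [rowCountMin]
      omega
  have h1 := key (μ.colLen 0)
  have h2 := T.rowCountMax_le i (μ.colLen 0)
  rw [T.rowCount_eq_zero le_rfl] at h1 h2
  rw [← Finset.sum_add_distrib, ← Finset.sum_add_distrib]
  rw [Nat.le_zero.1 h2] at h1
  rw [add_zero, add_zero] at h1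
  rw [← h1]
  refine Finset.sum_congr rfl fun r _ => ?_
  have h3 := T.rowCountMin_le i r
  have h4 := T.le_rowCountMax i r
  unfold rowCountReflect
  omega

open Classical in
/-- The entries of the image of `T` under the Bender–Knuth involution. -/
noncomputable def benderKnuthEntry (T : SemistandardYoungTableau μ) (i r j : ℕ) : ℕ :=
  if (r, j) ∈ μ then
    if T r j = i ∨ T r j = i + 1 then
      if j < T.rowCountReflect i r then i else i + 1
    else T r j
  else 0

/-- Only the threshold `i + 1` is altered. The bounds on the reflected count keep it compatible with
the thresholds `i` and `i + 2`. -/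
theorem benderKnuthEntry_lt_iff (T : SemistandardYoungTableau μ) {i r j : ℕ} (hc : (r, j) ∈ μ)
    (v : ℕ) : T.benderKnuthEntry i r j < v ↔
      if v = i + 1 then j < T.rowCountReflect i r else T r j < v := by
  have h1 : T r j < i → j < T.rowCountReflect i r := fun h =>
    (T.lt_rowCount_iff.2 ⟨hc, h⟩).trans_le
      ((le_max_left _ _).trans (T.rowCountMin_le_reflect i r))
  have h2 : j < T.rowCountReflect i r → T r j < i + 2 := fun h =>
    (T.lt_rowCount_iff.1 (h.trans_le
      ((T.rowCountReflect_le_max i r).trans (T.rowCountMax_le i r)))).2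
  unfold benderKnuthEntry
  rw [if_pos hc]
  split_ifs <;> omega

theorem benderKnuthEntry_lt_succ (T : SemistandardYoungTableau μ) {i r j : ℕ}
    (hc : (r + 1, j) ∈ μ) : T.benderKnuthEntry i r j < T.benderKnuthEntry i (r + 1) j := by
  have hc' : (r, j) ∈ μ := μ.up_left_mem (Nat.le_add_right r 1) le_rfl hc
  by_contra! hle
  have h1 := (T.benderKnuthEntry_lt_iff hc _).1 (Nat.lt_succ_of_le hle)
  have h2 := (T.benderKnuthEntry_lt_iff hc' (T.benderKnuthEntry i r j)).not.1 (lt_irrefl _)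
  generalize T.benderKnuthEntry i r j = v at h1 h2
  have h3 := T.col_strict (Nat.lt_add_one r) hc
  by_cases hv : v = i + 1
  · subst hv
    rw [if_neg (by omega)] at h1
    rw [if_pos rfl] at h2
    have h4 : j < T.rowCount (r + 1) (i + 2) := T.lt_rowCount_iff.2 ⟨hc, h1⟩
    exact h2 (h4.trans_le ((le_max_right _ _).trans (T.rowCountMin_le_reflect i r)))
  · rw [if_neg hv] at h2
    by_cases hv' : v = i
    · subst hv'
      rw [if_pos rfl] at h1
      have h4 : j < T.rowCount r v :=
        (h1.trans_le (T.rowCountReflect_le_max v (r + 1))).trans_le (min_le_right _ _)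
      exact h2 (T.lt_rowCount_iff.1 h4).2
    · rw [if_neg (by omega)] at h1
      omega

/-- The Bender–Knuth involution, which exchanges the multiplicities of the entries `i` and
`i + 1`. -/
noncomputable def benderKnuth (i : ℕ) (T : SemistandardYoungTableau μ) :
    SemistandardYoungTableau μ where
  entry := T.benderKnuthEntry i
  row_weak' := by
    intro r j1 j2 hj hc
    have hc1 : (r, j1) ∈ μ := μ.up_left_mem le_rfl hj.le hc
    by_contra! hlt
    have h1 := (T.benderKnuthEntry_lt_iff hc _).1 hlt
    have h2 := (T.benderKnuthEntry_lt_iff hc1 (T.benderKnuthEntry i r j1)).not.1 (lt_irrefl _)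
    have h3 := T.row_weak hj hc
    split_ifs at h1 h2 <;> omega
  col_strict' := by
    intro r1 r2 j hr
    induction r2, hr using Nat.le_induction with
    | base => exact T.benderKnuthEntry_lt_succ
    | succ r hr ih =>
      intro hc
      exact (ih (μ.up_left_mem (Nat.le_add_right r 1) le_rfl hc)).trans (T.benderKnuthEntry_lt_succ hc)
  zeros' := fun hc => if_neg hc

theorem rowCount_benderKnuth (i : ℕ) (T : SemistandardYoungTableau μ) (r v : ℕ) :
    (T.benderKnuth i).rowCount r v =
      if v = i + 1 then T.rowCountReflect i r else T.rowCount r v := by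
  have key : ∀ j, j < (T.benderKnuth i).rowCount r v ↔
      j < if v = i + 1 then T.rowCountReflect i r else T.rowCount r v := by
    intro j
    rw [lt_rowCount_iff]
    constructor
    · rintro ⟨h1, h2⟩
      have := (T.benderKnuthEntry_lt_iff h1 v).1 h2
      split_ifs at this ⊢
      · exact this
      · exact T.lt_rowCount_iff.2 ⟨h1, this⟩
    · intro h
      have hc : (r, j) ∈ μ := by
        split_ifs at h
        · exact (T.lt_rowCount_iff.1 (h.trans_le
            ((T.rowCountReflect_le_max i r).trans (T.rowCountMax_le i r)))).1
        · exact (T.lt_rowCount_iff.1 h).1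
      refine ⟨hc, (T.benderKnuthEntry_lt_iff hc v).2 ?_⟩
      split_ifs at h ⊢
      · exact h
      · exact (T.lt_rowCount_iff.1 h).2
  exact le_antisymm (le_of_not_gt fun h => lt_irrefl _ ((key _).1 h))
    (le_of_not_gt fun h => lt_irrefl _ ((key _).2 h))

/-- The bounds of the reflection involve only thresholds other than `i + 1`, which are unchanged, so
the reflection can be undone. -/
theorem benderKnuth_injective (i : ℕ) :
    Function.Injective (benderKnuth i : SemistandardYoungTableau μ → _) := by
  intro T T' h
  have h0 : ∀ r v, _ = _ := fun r v => congrArg (fun T => T.rowCount r v) h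
  simp only [rowCount_benderKnuth] at h0
  have h1 : ∀ r v, v ≠ i + 1 → T.rowCount r v = T'.rowCount r v := by
    intro r v hv
    have := h0 r v
    rwa [if_neg hv, if_neg hv] at this
  have hmin : ∀ r, T.rowCountMin i r = T'.rowCountMin i r := by
    intro r
    rw [rowCountMin, rowCountMin, h1 _ _ (by omega), h1 _ _ (by omega)]
  have hmax : ∀ r, T.rowCountMax i r = T'.rowCountMax i r := by
    intro r
    cases r with
    | zero => exact h1 _ _ (by omega)
    | succ r =>
      rw [rowCountMax, rowCountMax, h1 _ _ (by omega), h1 _ _ (by omega)]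
  refine ext_rowCount fun r v => ?_
  by_cases hv : v = i + 1
  · subst hv
    have h2 := h0 r (i + 1)
    rw [if_pos rfl, if_pos rfl, rowCountReflect, rowCountReflect, hmin, hmax] at h2
    have h3 := T.rowCountMin_le i r
    have h4 := T.le_rowCountMax i r
    have h5 := T'.rowCountMin_le i r
    have h6 := T'.le_rowCountMax i r
    rw [hmin] at h3
    rw [hmax] at h4
    omega
  · exact h1 r v hv

theorem weight_benderKnuth (i : ℕ) (T : SemistandardYoungTableau μ) :
    (T.benderKnuth i).weight = T.weight.equivMapDomain (Equiv.swap i (i + 1)) := by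
  ext v
  rw [Finsupp.equivMapDomain_apply, Equiv.symm_swap]
  have h1 := (T.benderKnuth i).weight_add_sum_rowCount v
  have h2 := T.weight_add_sum_rowCount i
  have h3 := T.weight_add_sum_rowCount (i + 1)
  have h4 : _ + _ = _ + ∑ r ∈ Finset.range (μ.colLen 0), T.rowCount r (i + 1 + 1) :=
    T.sum_rowCountReflect i
  simp only [rowCount_benderKnuth] at h1
  by_cases hv : v = i
  · subst hv
    simp only [if_true, (Nat.succ_ne_self v).symm, if_false] at h1
    rw [Equiv.swap_apply_left]
    omega
  · by_cases hv' : v = i + 1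
    · subst hv'
      simp only [Nat.succ_ne_self, if_true, if_false] at h1
      rw [Equiv.swap_apply_right]
      omega
    · have h5 := T.weight_add_sum_rowCount v
      rw [Equiv.swap_apply_of_ne_of_ne hv hv']
      simp only [hv', if_false, Nat.add_right_cancel_iff, hv] at h1
      omega

end SemistandardYoungTableau

/-! ### Symmetry of the two series -/

/-- The coefficients of `f` are invariant under exchanging two consecutive variables. -/
def IsSwapInvariant (f : MvPowerSeries ℕ ℤ) : Prop :=
  ∀ (i : ℕ) (d : ℕ →₀ ℕ), f.coeff (d.equivMapDomain (Equiv.swap i (i + 1))) = f.coeff d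

theorem Finsupp.equivMapDomain_swap_swap (i j : ℕ) (d : ℕ →₀ ℕ) :
    (d.equivMapDomain (Equiv.swap i j)).equivMapDomain (Equiv.swap i j) = d := by
  ext v
  simp [Finsupp.equivMapDomain_apply]

theorem isSwapInvariant_of_injection (α : Type*) (wt : α → ℕ →₀ ℕ) (σ : ℕ → α → α)
    (hσ : ∀ i, Function.Injective (σ i))
    (hwt : ∀ i a, wt (σ i a) = (wt a).equivMapDomain (Equiv.swap i (i + 1))) :
    IsSwapInvariant (fun d => (Nat.card {a // wt a = d} : ℤ)) := by
  intro i d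
  have F : ∀ d, Nonempty ({a // wt a = d} ↪
      {a // wt a = d.equivMapDomain (Equiv.swap i (i + 1))}) := fun d =>
    ⟨⟨fun a => ⟨σ i a.1, by rw [hwt, a.2]⟩,
      fun a b h => Subtype.ext (hσ i (congrArg Subtype.val h))⟩⟩
  obtain ⟨f⟩ := F d
  obtain ⟨g⟩ := F (d.equivMapDomain (Equiv.swap i (i + 1)))
  rw [Finsupp.equivMapDomain_swap_swap] at g
  -- The exchange is its own inverse on weights, so there are injections both ways and
  -- Schröder–Bernstein applies.
  obtain ⟨e⟩ := Function.Embedding.antisymm f g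
  exact congrArg Nat.cast (Nat.card_congr e).symm

theorem isSwapInvariant_schurFunction (μ : YoungDiagram) : IsSwapInvariant (schurFunction μ) :=
  isSwapInvariant_of_injection _ _ (fun i T => T.benderKnuth i)
    SemistandardYoungTableau.benderKnuth_injective
    SemistandardYoungTableau.weight_benderKnuth

theorem isSwapInvariant_chromaticSymmetricFunction {V : Type*} [Fintype V] (G : SimpleGraph V) :
    IsSwapInvariant (chromaticSymmetricFunction G) := by
  refine isSwapInvariant_of_injection (G.Coloring ℕ)
    (fun κ => ∑ v, Finsupp.single (κ v) 1)
    (fun i κ => SimpleGraph.Coloring.mk (fun v => Equiv.swap i (i + 1) (κ v))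
      fun {u v} h he => κ.valid h ((Equiv.injective _) he)) ?_ ?_
  · intro i κ κ' h
    ext v
    have := congrArg (fun κ : G.Coloring ℕ => κ v) h
    exact (Equiv.swap i (i + 1)).injective this
  · intro i κ
    simp only [Finsupp.equivMapDomain_eq_mapDomain, Finsupp.mapDomain_finsetSum,
      Finsupp.mapDomain_single]
    rfl

/-! ### Unitriangularity and the Schur expansion -/

theorem degree_sum_single {α : Type*} (s : Finset α) (f : α → ℕ) :
    (∑ c ∈ s, Finsupp.single (f c) 1).degree = s.card := by
  rw [map_sum, Finset.card_eq_sum_ones]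
  exact Finset.sum_congr rfl fun c _ => Finsupp.degree_single _ _

theorem weight_sum_single {α : Type*} (s : Finset α) (f : α → ℕ) :
    Finsupp.weight (id : ℕ → ℕ) (∑ c ∈ s, Finsupp.single (f c) 1) = ∑ c ∈ s, f c := by
  rw [map_sum]
  exact Finset.sum_congr rfl fun c _ => by simp [Finsupp.weight_single]

namespace YoungDiagram

/-- The sum of the row indices of the cells. -/
def rowSum (μ : YoungDiagram) : ℕ := ∑ c ∈ μ.cells, c.1

/-- The exponent vector of the row lengths. -/
noncomputable def rowWeight (μ : YoungDiagram) : ℕ →₀ ℕ := ∑ c ∈ μ.cells, Finsupp.single c.1 1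

theorem rowWeight_apply (μ : YoungDiagram) (i : ℕ) : μ.rowWeight i = μ.rowLen i := by
  rw [rowWeight, Finsupp.finsetSum_apply, rowLen_eq_card, row, Finset.card_filter]
  exact Finset.sum_congr rfl fun c _ => Finsupp.single_apply

theorem rowWeight_injective : Function.Injective rowWeight := by
  intro μ ν h
  ext ⟨i, j⟩
  rw [mem_cells, mem_cells, mem_iff_lt_rowLen, mem_iff_lt_rowLen, ← rowWeight_apply, h,
    rowWeight_apply]

theorem degree_rowWeight (μ : YoungDiagram) : μ.rowWeight.degree = μ.card :=
  degree_sum_single _ _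

theorem exists_rowWeight_eq {d : ℕ →₀ ℕ} (hd : Antitone d) : ∃ μ : YoungDiagram, μ.rowWeight = d := by
  let μ : YoungDiagram :=
    { cells := (d.support ×ˢ Finset.range (d 0)).filter fun c => c.2 < d c.1
      isLowerSet := by
        rintro ⟨a, b⟩ ⟨a', b'⟩ ⟨h1, h2⟩ h
        simp only [Finset.coe_filter, Finset.mem_product, Finsupp.mem_support_iff,
          Finset.mem_range, Set.mem_ofPred_eq] at h h1 h2 ⊢
        have h3 := hd h1
        have h4 := hd (Nat.zero_le a')
        omega }
  have hμ : ∀ i j, (i, j) ∈ μ ↔ j < d i := by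
    intro i j
    rw [← mem_cells]
    simp only [μ, Finset.mem_filter, Finset.mem_product, Finsupp.mem_support_iff,
      Finset.mem_range]
    have := hd (Nat.zero_le i)
    omega
  refine ⟨μ, ?_⟩
  ext i
  rw [rowWeight_apply]
  have key : ∀ j, j < μ.rowLen i ↔ j < d i := fun j => by rw [← mem_iff_lt_rowLen, hμ]
  have h1 := key (μ.rowLen i)
  have h2 := key (d i)
  omega

theorem finite_setOf_card_eq (n : ℕ) : {μ : YoungDiagram | μ.card = n}.Finite := by
  have hinj : Function.Injective (fun μ : YoungDiagram => μ.cells) := fun μ ν h =>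
    YoungDiagram.ext h
  refine Set.Finite.subset (Set.Finite.preimage hinj.injOn
    (Finset.finite_toSet (Finset.range n ×ˢ Finset.range n).powerset)) ?_
  rintro μ rfl
  simp only [Set.mem_preimage, Finset.mem_coe, Finset.mem_powerset]
  rintro ⟨i, j⟩ hc
  rw [mem_cells] at hc
  rw [Finset.mem_product, Finset.mem_range, Finset.mem_range]
  constructor
  · have := Finset.card_le_card_of_injOn (s := Finset.range (i + 1)) (t := μ.cells)
      (fun a => (a, j)) (fun a ha => by
        have : a < i + 1 := by simpa using ha
        simpa using μ.up_left_mem (by omega) le_rfl hc) (fun a _ b _ h => congrArg Prod.fst h)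
    simpa using this
  · have := Finset.card_le_card_of_injOn (s := Finset.range (j + 1)) (t := μ.cells)
      (fun a => (i, a)) (fun a ha => by
        have : a < j + 1 := by simpa using ha
        simpa using μ.up_left_mem le_rfl (by omega) hc) (fun a _ b _ h => congrArg Prod.snd h)
    simpa using this

end YoungDiagram

open YoungDiagram

theorem SemistandardYoungTableau.le_apply {μ : YoungDiagram} (T : SemistandardYoungTableau μ)
    {i j : ℕ} (hc : (i, j) ∈ μ) : i ≤ T i j := by
  induction i with
  | zero => exact Nat.zero_le _
  | succ i ih =>
    exact (ih (μ.up_left_mem (Nat.le_add_right i 1) le_rfl hc)).trans_lt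
      (T.col_strict (Nat.lt_add_one i) hc)

/-- The entries of T sum to `ν.rowSum`, and each is at least its row index. -/
theorem SemistandardYoungTableau.rowSum_le {μ ν : YoungDiagram} {T : SemistandardYoungTableau μ}
    (hT : T.weight = ν.rowWeight) : μ.rowSum ≤ ν.rowSum := by
  have h1 := congrArg (Finsupp.weight (id : ℕ → ℕ)) hT
  rw [weight, rowWeight, weight_sum_single, weight_sum_single] at h1
  rw [rowSum, rowSum, ← h1]
  exact Finset.sum_le_sum fun c hc => T.le_apply hc

theorem SemistandardYoungTableau.eq_highestWeight {μ ν : YoungDiagram}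
    {T : SemistandardYoungTableau μ} (hT : T.weight = ν.rowWeight) (h : μ.rowSum = ν.rowSum) :
    T = highestWeight μ := by
  have h1 := congrArg (Finsupp.weight (id : ℕ → ℕ)) hT
  rw [weight, rowWeight, weight_sum_single, weight_sum_single] at h1
  have h2 : ∑ c ∈ μ.cells, c.1 = ∑ c ∈ μ.cells, T c.1 c.2 := h.trans h1.symm
  rw [Finset.sum_eq_sum_iff_of_le fun c hc => T.le_apply hc] at h2
  ext i j
  rw [highestWeight_apply]
  split_ifs with hc
  · exact (h2 (i, j) hc).symm
  · exact T.zeros hc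

theorem SemistandardYoungTableau.weight_highestWeight (μ : YoungDiagram) :
    (highestWeight μ).weight = μ.rowWeight := by
  refine Finset.sum_congr rfl fun c hc => ?_
  rw [highestWeight_apply, if_pos (YoungDiagram.mem_cells c |>.1 hc)]

theorem coeff_schurFunction_self (μ : YoungDiagram) :
    (schurFunction μ).coeff μ.rowWeight = 1 := by
  change (Nat.card {T : SemistandardYoungTableau μ // T.weight = μ.rowWeight} : ℤ) = 1
  rw [Nat.cast_eq_one, Nat.card_eq_one_iff_unique]
  exact ⟨⟨fun T T' => Subtype.ext ((T.1.eq_highestWeight T.2 rfl).trans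
    (T'.1.eq_highestWeight T'.2 rfl).symm)⟩,
    ⟨⟨_, SemistandardYoungTableau.weight_highestWeight μ⟩⟩⟩

theorem exists_tableau_of_coeff_schurFunction_ne_zero {μ : YoungDiagram} {d : ℕ →₀ ℕ}
    (h : (schurFunction μ).coeff d ≠ 0) : ∃ T : SemistandardYoungTableau μ, T.weight = d := by
  by_contra! hT
  refine h ?_
  change (Nat.card {T : SemistandardYoungTableau μ // T.weight = d} : ℤ) = 0
  have : IsEmpty {T : SemistandardYoungTableau μ // T.weight = d} := ⟨fun T => hT T.1 T.2⟩
  rw [Nat.card_of_isEmpty, Nat.cast_zero]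

theorem coeff_schurFunction_rowWeight_eq_zero {μ ν : YoungDiagram} (h : ν.rowSum ≤ μ.rowSum)
    (hne : μ ≠ ν) : (schurFunction μ).coeff ν.rowWeight = 0 := by
  by_contra h0
  obtain ⟨T, hT⟩ := exists_tableau_of_coeff_schurFunction_ne_zero h0
  have h1 := SemistandardYoungTableau.eq_highestWeight hT (le_antisymm (T.rowSum_le hT) h)
  rw [h1, SemistandardYoungTableau.weight_highestWeight] at hT
  exact hne (rowWeight_injective hT)

theorem linearIndependent_schurFunction : LinearIndependent ℤ schurFunction := by
  classical
  rw [linearIndependent_iff]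
  intro c hc
  by_contra hne
  -- For μ of least `rowSum` in the support, only the term of μ contributes to the coefficient at
  -- `μ.rowWeight`.
  obtain ⟨μ, hμ, hmin⟩ := c.support.exists_min_image rowSum (Finsupp.support_nonempty_iff.2 hne)
  have h1 := congrArg (MvPowerSeries.coeff μ.rowWeight) hc
  rw [Finsupp.linearCombination_apply, Finsupp.sum, map_sum, map_zero,
    Finset.sum_eq_single μ] at h1
  · rw [map_zsmul, coeff_schurFunction_self, smul_eq_mul, mul_one] at h1
    exact Finsupp.mem_support_iff.1 hμ h1
  · intro ν hν hνμ
    rw [map_zsmul, coeff_schurFunction_rowWeight_eq_zero (hmin ν hν) hνμ, smul_zero]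
  · exact fun h => absurd hμ h

/-- Sorting an exponent vector by exchanges of consecutive variables. -/
theorem IsSwapInvariant.eq_zero {f : MvPowerSeries ℕ ℤ} (hf : IsSwapInvariant f)
    (h : ∀ d : ℕ →₀ ℕ, Antitone d → f.coeff d = 0) : f = 0 := by
  ext d
  rw [map_zero]
  -- The measure is the sum of `v * d v`; exchanging an ascent `d i < d (i + 1)` lowers it.
  induction hN : Finsupp.weight (id : ℕ → ℕ) d using Nat.strong_induction_on generalizing d with
  | _ N ih =>
    subst hN
    by_cases hd : Antitone d
    · exact h d hd
    · obtain ⟨i, hi⟩ : ∃ i, d i < d (i + 1) := by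
        by_contra! hi
        exact hd (antitone_nat_of_succ_le hi)
      rw [← hf i d]
      refine ih _ ?_ _ rfl
      have h1 : d = (d.erase i).erase (i + 1) + Finsupp.single i (d i) +
          Finsupp.single (i + 1) (d (i + 1)) := by
        ext v
        by_cases hv : v = i <;> by_cases hv' : v = i + 1 <;>
          simp_all [eq_comm]
      have h2 : d.equivMapDomain (Equiv.swap i (i + 1)) =
          (d.erase i).erase (i + 1) + Finsupp.single i (d (i + 1)) +
          Finsupp.single (i + 1) (d i) := by
        ext v
        rw [Finsupp.equivMapDomain_apply, Equiv.symm_swap]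
        by_cases hv : v = i
        · subst hv
          simp
        · by_cases hv' : v = i + 1
          · subst hv'
            simp
          · rw [Equiv.swap_apply_of_ne_of_ne hv hv']
            simp [hv, hv']
      rw [h2]
      conv_rhs => rw [h1]
      simp only [map_add, Finsupp.weight_single, id, smul_eq_mul]
      nlinarith

theorem IsSwapInvariant.sub {f g : MvPowerSeries ℕ ℤ} (hf : IsSwapInvariant f)
    (hg : IsSwapInvariant g) : IsSwapInvariant (f - g) := by
  intro i d
  rw [map_sub, map_sub, hf, hg]

theorem IsSwapInvariant.sum_smul {ι : Type*} (s : Finset ι) (a : ι → ℤ)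
    (f : ι → MvPowerSeries ℕ ℤ) (hf : ∀ j, IsSwapInvariant (f j)) :
    IsSwapInvariant (∑ j ∈ s, a j • f j) := by
  intro i d
  simp only [map_sum, map_zsmul, hf _ i d]

/-- A homogeneous symmetric power series is a linear combination of Schur functions. -/
theorem IsSwapInvariant.mem_span_schurFunction (n : ℕ) {f : MvPowerSeries ℕ ℤ}
    (hf : IsSwapInvariant f) (hn : ∀ d : ℕ →₀ ℕ, d.degree ≠ n → f.coeff d = 0) :
    f ∈ Submodule.span ℤ (Set.range schurFunction) := by
  classical
  let Y := (finite_setOf_card_eq n).toFinset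
  have hY : ∀ μ, μ ∈ Y ↔ μ.card = n := fun μ => by simp [Y]
  -- Elimination by levels of `rowSum`: those below t are already cleared, and s bounds the number
  -- still to clear.
  have key : ∀ (s t : ℕ), Y.sup rowSum < s + t → ∀ f : MvPowerSeries ℕ ℤ, IsSwapInvariant f →
      (∀ d : ℕ →₀ ℕ, d.degree ≠ n → f.coeff d = 0) →
      (∀ μ ∈ Y, μ.rowSum < t → f.coeff μ.rowWeight = 0) →
      f ∈ Submodule.span ℤ (Set.range schurFunction) := by
    intro s
    induction s with
    | zero =>
      intro t ht f hf hn h0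
      have : f = 0 := by
        refine hf.eq_zero fun d hd => ?_
        obtain ⟨μ, rfl⟩ := exists_rowWeight_eq hd
        by_cases hμ : μ.card = n
        · refine h0 μ ((hY μ).2 hμ) ?_
          have := Finset.le_sup (f := rowSum) ((hY μ).2 hμ)
          omega
        · exact hn _ (by rwa [degree_rowWeight])
      rw [this]
      exact Submodule.zero_mem _
    | succ s ih =>
      intro t ht f hf hn h0
      -- By unitriangularity, subtracting g clears level t and leaves the lower levels untouched.
      let g := ∑ μ ∈ Y.filter (fun μ => μ.rowSum = t), f.coeff μ.rowWeight • schurFunction μ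
      have hg : g ∈ Submodule.span ℤ (Set.range schurFunction) :=
        Submodule.sum_mem _ fun μ _ => Submodule.smul_mem _ _ (Submodule.subset_span ⟨μ, rfl⟩)
      rw [← sub_add_cancel f g]
      refine Submodule.add_mem _ (ih (t + 1) (by omega) _ (hf.sub ?_) ?_ ?_) hg
      · exact IsSwapInvariant.sum_smul _ _ _ isSwapInvariant_schurFunction
      · intro d hd
        rw [map_sub, hn d hd, zero_sub, neg_eq_zero, map_sum]
        refine Finset.sum_eq_zero fun μ hμ => ?_
        rw [map_zsmul]
        by_contra hne
        obtain ⟨T, rfl⟩ := exists_tableau_of_coeff_schurFunction_ne_zero (right_ne_zero_of_smul hne)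
        rw [SemistandardYoungTableau.weight, degree_sum_single] at hd
        exact hd ((hY μ).1 (Finset.mem_filter.1 hμ).1)
      · intro μ hμ hlt
        rw [map_sub, map_sum]
        rcases Nat.lt_succ_iff_lt_or_eq.1 hlt with hlt | heq
        · rw [h0 μ hμ hlt, zero_sub, neg_eq_zero]
          refine Finset.sum_eq_zero fun ν hν => ?_
          have hν := (Finset.mem_filter.1 hν).2
          rw [map_zsmul, coeff_schurFunction_rowWeight_eq_zero (by omega)
            (fun h => by subst h; omega), smul_zero]
        · rw [Finset.sum_eq_single μ]
          · rw [map_zsmul, coeff_schurFunction_self, smul_eq_mul, mul_one, sub_self]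
          · intro ν hν hne
            have hν := (Finset.mem_filter.1 hν).2
            rw [map_zsmul, coeff_schurFunction_rowWeight_eq_zero (by omega) hne, smul_zero]
          · exact fun h => absurd (Finset.mem_filter.2 ⟨hμ, heq⟩) h
  exact key (Y.sup rowSum + 1) 0 (by omega) f hf hn fun μ _ h => absurd h (Nat.not_lt_zero _)

theorem coeff_chromaticSymmetricFunction_eq_zero {V : Type*} [Fintype V] (G : SimpleGraph V)
    {d : ℕ →₀ ℕ} (hd : d.degree ≠ Fintype.card V) :
    (chromaticSymmetricFunction G).coeff d = 0 := by
  change (Nat.card {κ : G.Coloring ℕ // ∑ v, Finsupp.single (κ v) 1 = d} : ℤ) = 0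
  have : IsEmpty {κ : G.Coloring ℕ // ∑ v, Finsupp.single (κ v) 1 = d} :=
    ⟨fun κ => hd (by rw [← κ.2, degree_sum_single, Finset.card_univ])⟩
  rw [Nat.card_of_isEmpty, Nat.cast_zero]

theorem existsUnique_isSchurExpansion {V : Type*} [Fintype V] (G : SimpleGraph V) :
    ∃! c : YoungDiagram →₀ ℤ, IsSchurExpansion (chromaticSymmetricFunction G) c := by
  have h1 := (isSwapInvariant_chromaticSymmetricFunction G).mem_span_schurFunction
    (Fintype.card V) fun d hd => coeff_chromaticSymmetricFunction_eq_zero G hd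
  obtain ⟨c, hc⟩ := (Finsupp.mem_span_range_iff_exists_finsupp).1 h1
  refine ⟨c, hc.symm, fun c' hc' => ?_⟩
  refine linearIndependent_schurFunction ?_
  rw [Finsupp.linearCombination_apply, Finsupp.linearCombination_apply]
  exact hc'.symm.trans hc.symm

/-! ### The hook functional on both series -/

/-- The side condition K lets one bijection serve both series: it is trivial for X_G and
monotonicity for s_μ. -/
theorem card_colourings_eq_card_blockWords {V : Type*} [Fintype V] {r : V → V → Prop}
    (hirr : ∀ v, ¬ r v v) (htr : ∀ u v w, r u v → r v w → r u w) {n : ℕ} {γ : Fin n → ℕ}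
    (hγ : Monotone γ) (K : (V → ℕ) → Prop) :
    Nat.card {κ : V → ℕ // ((∀ u v, u ≠ v → κ u = κ v → r u v ∨ r v u) ∧ K κ) ∧
        ∑ v, Finsupp.single (κ v) 1 = ∑ p, Finsupp.single (γ p) 1} =
      Nat.card {w : Fin n ≃ V // IsBlockWord r γ w ∧ K fun v => γ (w.symm v)} := by
  symm
  refine Nat.card_eq_of_bijective (fun w => ⟨fun v => γ (w.1.symm v), ⟨?_, w.2.2⟩, ?_⟩) ⟨?_, ?_⟩
  · intro u v hne he
    rcases lt_or_gt_of_ne (w.1.symm.injective.ne hne) with h | h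
    · have := w.2.1 _ _ h he
      simp only [Equiv.apply_symm_apply] at this
      exact Or.inl this
    · have := w.2.1 _ _ h he.symm
      simp only [Equiv.apply_symm_apply] at this
      exact Or.inr this
  · exact Equiv.sum_comp w.1.symm fun p => Finsupp.single (γ p) 1
  · intro w w' h
    refine Subtype.ext (IsBlockWord.eq_of_colour_eq hirr htr hγ w.2.1 w'.2.1 fun v => ?_)
    exact congrFun (congrArg Subtype.val h) v
  · rintro ⟨κ, ⟨h1, h2⟩, h3⟩
    obtain ⟨w, hw, hκ⟩ := exists_isBlockWord hirr htr hγ h1 h3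
    have h4 : (fun v => γ (w.symm v)) = κ := by
      ext v
      rw [← hκ, Equiv.apply_symm_apply]
    exact ⟨⟨w, hw, h4 ▸ h2⟩, Subtype.ext h4⟩

/-- The alternating sum of coefficients that extracts the coefficient of a hook with `m` parts `1`
after the first part from a Schur expansion in degree `n`. -/
noncomputable def hookFunctional (n m : ℕ) : MvPowerSeries ℕ ℤ →ₗ[ℤ] ℤ :=
  ∑ S ∈ (Finset.Icc 1 m).powerset, (-1 : ℤ) ^ (m - S.card) •
    MvPowerSeries.coeff (∑ p : Fin n, Finsupp.single (cutColour S p) 1)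

theorem hookFunctional_apply (n m : ℕ) (f : MvPowerSeries ℕ ℤ) :
    hookFunctional n m f = ∑ S ∈ (Finset.Icc 1 m).powerset, (-1 : ℤ) ^ (m - S.card) *
      f.coeff (∑ p : Fin n, Finsupp.single (cutColour S p) 1) := by
  rw [hookFunctional, LinearMap.sum_apply]
  exact Finset.sum_congr rfl fun S _ => LinearMap.smul_apply _ _ _

theorem hookFunctional_chromaticSymmetricFunction (P : Type*) [PartialOrder P] [Fintype P]
    {n m : ℕ} (hm : m < n) :
    hookFunctional n m (chromaticSymmetricFunction (incomparabilityGraph P)) =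
      Nat.card {w : Fin n ≃ P // IsHookWord (· < ·) m w} := by
  have h1 := sum_neg_one_pow_card_blockWords (V := P) (r := (· < ·))
    (fun _ _ _ => lt_trans) hm fun _ => True
  simp only [and_true] at h1
  rw [← h1, hookFunctional_apply]
  refine Finset.sum_congr rfl fun S _ => ?_
  congr 1
  have h2 := card_colourings_eq_card_blockWords (V := P) (r := (· < ·)) lt_irrefl
    (fun _ _ _ => lt_trans) (cutColour_monotone S n) fun _ => True
  simp only [and_true] at h2
  rw [← h2]
  refine congrArg Nat.cast (Nat.card_congr ?_)
  refine ⟨fun κ => ⟨κ.1, fun u v hne he => ?_, κ.2⟩,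
    fun κ => ⟨SimpleGraph.Coloring.mk κ.1 fun {u v} h he => ?_, κ.2.2⟩,
    fun κ => rfl, fun κ => rfl⟩
  · by_contra! h
    refine κ.1.valid (v := u) (w := v) ⟨fun h1 => ?_, fun h1 => ?_⟩ he
    · exact h.1 (lt_of_le_of_ne h1 hne)
    · exact h.2 (lt_of_le_of_ne h1 hne.symm)
  · rcases κ.2.1 u v (fun h1 => h.1 h1.le) he with h1 | h1
    exacts [h.1 h1.le, h.2 h1.le]

/-- Semistandard tableaux as monotone fillings without equal entries in a column. -/
noncomputable def tableauEquivColouring (μ : YoungDiagram) (d : ℕ →₀ ℕ) :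
    {T : SemistandardYoungTableau μ // T.weight = d} ≃
      {κ : μ.cells → ℕ // ((∀ u v, u ≠ v → κ u = κ v →
        (u : ℕ × ℕ).2 < (v : ℕ × ℕ).2 ∨ (v : ℕ × ℕ).2 < (u : ℕ × ℕ).2) ∧ Monotone κ) ∧
        ∑ v, Finsupp.single (κ v) 1 = d} where
  toFun T := ⟨fun c => T.1 c.1.1 c.1.2, ⟨by
      rintro ⟨⟨a, b⟩, hu⟩ ⟨⟨a', b'⟩, hv⟩ hne he
      simp only at he ⊢
      by_contra! h
      obtain rfl : b = b' := by omega
      rcases lt_trichotomy a a' with h1 | rfl | h1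
      · exact (T.1.col_strict h1 hv).ne he
      · exact hne rfl
      · exact (T.1.col_strict h1 hu).ne' he, by
      rintro ⟨⟨a, b⟩, hu⟩ ⟨⟨a', b'⟩, hv⟩ h
      have h : a ≤ a' ∧ b ≤ b' := h
      exact (T.1.col_weak h.1 (μ.up_left_mem le_rfl h.2 hv)).trans (T.1.row_weak_of_le h.2 hv)⟩, by
      refine Eq.trans ?_ T.2
      exact Finset.sum_coe_sort μ.cells fun c => Finsupp.single (T.1 c.1 c.2) 1⟩
  invFun κ := ⟨{
      entry := fun i j => if h : (i, j) ∈ μ.cells then κ.1 ⟨(i, j), h⟩ else 0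
      row_weak' := by
        intro i j1 j2 hj hc
        have hc' : (i, j1) ∈ μ.cells := μ.up_left_mem le_rfl hj.le hc
        rw [dif_pos hc', dif_pos ((YoungDiagram.mem_cells _).2 hc)]
        exact κ.2.1.2 (Prod.mk_le_mk.2 ⟨le_rfl, hj.le⟩)
      col_strict' := by
        intro i1 i2 j hi hc
        have hc' : (i1, j) ∈ μ.cells := μ.up_left_mem hi.le le_rfl hc
        rw [dif_pos hc', dif_pos ((YoungDiagram.mem_cells _).2 hc)]
        refine lt_of_le_of_ne (κ.2.1.2 (Prod.mk_le_mk.2 ⟨hi.le, le_rfl⟩)) fun he => ?_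
        rcases κ.2.1.1 _ _ (fun h => hi.ne (congrArg (fun c => c.1.1) h)) he with h | h <;>
          exact lt_irrefl _ h
      zeros' := fun hc => dif_neg hc }, by
      refine Eq.trans ?_ κ.2.2
      rw [SemistandardYoungTableau.weight, ← Finset.sum_coe_sort]
      refine Finset.sum_congr rfl fun c _ => ?_
      congr 1
      exact dif_pos c.2⟩
  left_inv T := by
    refine Subtype.ext (SemistandardYoungTableau.ext fun i j => ?_)
    change (if h : (i, j) ∈ μ.cells then T.1 i j else 0) = T.1 i j
    split_ifs with h
    · rfl
    · exact (T.1.zeros h).symm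
  right_inv κ := by
    refine Subtype.ext (funext fun c => ?_)
    exact dif_pos c.2

theorem hookFunctional_schurFunction (μ : YoungDiagram) {n m : ℕ} (hm : m < n) :
    hookFunctional n m (schurFunction μ) =
      Nat.card {w : Fin n ≃ μ.cells //
        IsHookWord (fun u v : μ.cells => (u : ℕ × ℕ).2 < (v : ℕ × ℕ).2) m w ∧ Monotone w.symm} := by
  have htr : ∀ u v w : μ.cells, (u : ℕ × ℕ).2 < (v : ℕ × ℕ).2 → (v : ℕ × ℕ).2 < (w : ℕ × ℕ).2 →
    (u : ℕ × ℕ).2 < (w : ℕ × ℕ).2 := fun _ _ _ => lt_trans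
  rw [← sum_neg_one_pow_card_blockWords htr hm, hookFunctional_apply]
  refine Finset.sum_congr rfl fun S _ => ?_
  congr 1
  refine congrArg Nat.cast (((Nat.card_congr (tableauEquivColouring μ _)).trans
    (card_colourings_eq_card_blockWords (fun v : μ.cells => lt_irrefl (v : ℕ × ℕ).2) htr
      (cutColour_monotone S n) Monotone)).trans (Nat.card_congr (Equiv.subtypeEquivRight ?_)))
  refine fun w => and_congr_right fun hw => ⟨fun h c c' hc => ?_, fun h =>
    (cutColour_monotone S n).comp h⟩
  -- Two cells listed against their order would share a block, where columns strictly increase along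
  -- the word.
  by_contra! hlt
  have h1 := hw _ _ hlt (le_antisymm (cutColour_monotone S n hlt.le) (h hc))
  simp only [Equiv.apply_symm_apply] at h1
  exact absurd h1 (not_lt_of_ge hc.2)

/-! ### The unique hook word of cells -/

theorem mem_hookShape {k m : ℕ} {hk : 1 ≤ k} {i j : ℕ} :
    (i, j) ∈ hookShape k m hk ↔ (i = 0 ∧ j < k) ∨ (j = 0 ∧ i ≤ m) := by
  rw [hookShape, YoungDiagram.mem_ofRowLens]
  cases i with
  | zero =>
    simp
    omega
  | succ i =>
    simp
    omega

/-- The cell of a hook in position `p`, when the first column with `m + 1` cells is read first. -/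
def hookCell (m p : ℕ) : ℕ × ℕ := if p ≤ m then (p, 0) else (0, p - m)

/-- Each initial segment of w is a lower set of cells. The first m steps cannot move right, so they
descend the first column; each later step must move right, which forces the next cell of row 0. -/
theorem hookWord_apply {μ : YoungDiagram} {n m : ℕ} {w : Fin n ≃ μ.cells}
    (hw : IsHookWord (fun u v : μ.cells => (u : ℕ × ℕ).2 < (v : ℕ × ℕ).2) m w) (hmono : Monotone w.symm)
    (p : ℕ) (hp : p < n) : (w ⟨p, hp⟩ : ℕ × ℕ) = hookCell m p := by
  have hprev : ∀ (p : ℕ) (hp : p < n) (c : ℕ × ℕ), c ≤ (w ⟨p, hp⟩ : ℕ × ℕ) →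
      ∃ (q : ℕ) (hq : q < n), q ≤ p ∧ (w ⟨q, hq⟩ : ℕ × ℕ) = c := by
    intro p hp c hc
    have hcμ : c ∈ μ.cells := μ.isLowerSet hc (w ⟨p, hp⟩).2
    have h1 := hmono (show (⟨c, hcμ⟩ : μ.cells) ≤ w ⟨p, hp⟩ from hc)
    rw [Equiv.symm_apply_apply] at h1
    refine ⟨(w.symm ⟨c, hcμ⟩ : Fin n), (w.symm ⟨c, hcμ⟩).2, h1, ?_⟩
    simp
  induction p using Nat.strong_induction_on with
  | _ p ih =>
    cases p with
    | zero =>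
      obtain ⟨q, hq, hq0, hqc⟩ := hprev 0 hp (0, 0) ⟨Nat.zero_le _, Nat.zero_le _⟩
      obtain rfl := Nat.le_zero.1 hq0
      rw [hqc, hookCell, if_pos (Nat.zero_le m)]
    | succ p =>
      have h1 : _ < _ ↔ _ := hw p hp
      rw [ih p (Nat.lt_add_one p) (by omega)] at h1
      -- The expected cell then belongs to μ and is read by time `p + 1`; earlier positions hold
      -- other cells.
      suffices hc : hookCell m (p + 1) ≤ (w ⟨p + 1, hp⟩ : ℕ × ℕ) by
        obtain ⟨q, hq, hqp, hqc⟩ := hprev (p + 1) hp _ hc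
        rcases Nat.lt_or_eq_of_le hqp with hlt | rfl
        · rw [ih q hlt] at hqc
          simp only [hookCell] at hqc
          split_ifs at hqc <;> simp only [Prod.mk.injEq] at hqc <;> omega
        · exact hqc
      by_cases hpm : p + 1 ≤ m
      · have h2 : (w ⟨p + 1, hp⟩ : ℕ × ℕ).2 = 0 := by
          rw [hookCell, if_pos (by omega)] at h1
          simp only at h1
          omega
        rw [hookCell, if_pos hpm]
        refine ⟨?_, Nat.zero_le _⟩
        -- A higher cell of the first column has already been read, at the position equal to its
        -- row.
        by_contra! hlt
        have h3 := ih _ hlt (by omega)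
        rw [hookCell, if_pos (by simp only at hlt; omega)] at h3
        have h4 := w.injective (Subtype.ext (h3.trans (Prod.ext rfl h2.symm)))
        have h5 := congrArg Fin.val h4
        simp only at h5 hlt
        omega
      · rw [hookCell, if_neg hpm]
        refine ⟨Nat.zero_le _, ?_⟩
        have h2 := h1.2 (by omega)
        simp only [hookCell] at h2
        split_ifs at h2 <;> simp only at h2 ⊢ <;> omega

theorem hookCell_mem_hookShape {k m p : ℕ} {hk : 1 ≤ k} (hp : p < m + k) :
    hookCell m p ∈ hookShape k m hk := by
  rw [hookCell]
  split_ifs <;> rw [mem_hookShape] <;> omega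

/-- The word of the cells of a hook, column first. -/
def hookWord (k m : ℕ) (hk : 1 ≤ k) : Fin (m + k) ≃ (hookShape k m hk).cells where
  toFun p := ⟨hookCell m p, hookCell_mem_hookShape p.2⟩
  invFun c := ⟨if c.1.2 = 0 then c.1.1 else m + c.1.2, by
    obtain ⟨⟨i, j⟩, h⟩ := c
    have := mem_hookShape.1 h
    simp only
    split_ifs <;> omega⟩
  left_inv p := by
    refine Fin.ext ?_
    by_cases hp : (p : ℕ) ≤ m
    · simp [hookCell, hp]
    · simp only [hookCell, if_neg hp]
      rw [if_neg (by omega)]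
      omega
  right_inv c := by
    obtain ⟨⟨i, j⟩, h⟩ := c
    have := mem_hookShape.1 h
    refine Subtype.ext ?_
    by_cases hj : j = 0
    · simp only [hj, if_true, hookCell]
      rw [if_pos (by omega)]
    · simp only [if_neg hj, hookCell]
      rw [if_neg (by omega), Prod.mk.injEq]
      omega

theorem card_hookWords_cells (μ : YoungDiagram) (k m : ℕ) (hk : 1 ≤ k) :
    (Nat.card {w : Fin (m + k) ≃ μ.cells //
        IsHookWord (fun u v : μ.cells => (u : ℕ × ℕ).2 < (v : ℕ × ℕ).2) m w ∧ Monotone w.symm} : ℤ) =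
      Finsupp.single μ (1 : ℤ) (hookShape k m hk) := by
  by_cases hμ : μ = hookShape k m hk
  · subst hμ
    rw [Finsupp.single_eq_same, Nat.cast_eq_one, Nat.card_eq_one_iff_unique]
    refine ⟨⟨fun w w' => Subtype.ext (Equiv.ext fun p => Subtype.ext ?_)⟩,
      ⟨⟨hookWord k m hk, ?_, ?_⟩⟩⟩
    · exact (hookWord_apply w.2.1 w.2.2 p p.2).trans (hookWord_apply w'.2.1 w'.2.2 p p.2).symm
    · intro p hp
      simp only [hookWord, Equiv.coe_fn_mk, hookCell]
      split_ifs <;> simp only <;> omega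
    · rintro ⟨⟨i, j⟩, hc⟩ ⟨⟨i', j'⟩, hc'⟩ h
      have h : i ≤ i' ∧ j ≤ j' := h
      have h1 := mem_hookShape.1 hc
      have h2 := mem_hookShape.1 hc'
      change (if j = 0 then i else m + j) ≤ (if j' = 0 then i' else m + j')
      split_ifs <;> omega
  · rw [Finsupp.single_eq_of_ne (Ne.symm hμ), Nat.cast_eq_zero]
    refine @Nat.card_of_isEmpty _ ⟨fun w => hμ ?_⟩
    have happ := hookWord_apply w.2.1 w.2.2
    ext c
    constructor
    · intro hc
      have h1 := happ _ (w.1.symm ⟨c, hc⟩).2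
      simp only [Fin.eta, Equiv.apply_symm_apply] at h1
      rw [h1]
      exact hookCell_mem_hookShape (w.1.symm ⟨c, hc⟩).2
    · intro hc
      have h1 := congrArg Subtype.val ((hookWord k m hk).apply_symm_apply ⟨c, hc⟩)
      have h2 := happ _ ((hookWord k m hk).symm ⟨c, hc⟩).2
      have h3 : hookCell m ((hookWord k m hk).symm ⟨c, hc⟩) = c := h1
      rw [← h3, ← h2]
      exact (w.1 _).2

/-! ### P-tableaux of hook shape as words -/

/-- The position of a cell of a hook in the word that reads the first column upwards and then the
first row. -/
def hookPosition (k m : ℕ) (hk : 1 ≤ k) : {c : ℕ × ℕ // c ∈ hookShape k m hk} ≃ Fin (m + k) where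
  toFun c := ⟨m - c.1.1 + c.1.2, by
    obtain ⟨⟨i, j⟩, h⟩ := c
    have := mem_hookShape.1 h
    simp only
    omega⟩
  invFun p := ⟨(m - p, p - m), by
    have := p.2
    rw [mem_hookShape]
    omega⟩
  left_inv c := by
    obtain ⟨⟨i, j⟩, h⟩ := c
    have := mem_hookShape.1 h
    refine Subtype.ext (Prod.ext ?_ ?_) <;> simp only <;> omega
  right_inv p := by
    refine Fin.ext ?_
    simp only
    omega

theorem hookPosition_symm_apply {k m : ℕ} {hk : 1 ≤ k} {p : ℕ} (hp : p < m + k) {i j : ℕ}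
    (hi : m - p = i) (hj : p - m = j) : (hookPosition k m hk).symm ⟨p, hp⟩ =
      ⟨(i, j), by rw [mem_hookShape]; omega⟩ := by
  subst hi hj
  rfl

/-- Tableaux of hook shape as words. -/
def pTableauEquivHookWord (P : Type*) [PartialOrder P] (k m : ℕ) (hk : 1 ≤ k) :
    PTableau P (hookShape k m hk) ≃ {w : Fin (m + k) ≃ P // IsHookWord (· < ·) m w} where
  toFun t := ⟨(hookPosition k m hk).symm.trans t.entry, by
    intro p hp
    simp only [Equiv.trans_apply]
    by_cases hmp : m ≤ p
    · rw [hookPosition_symm_apply (i := 0) (j := p - m) _ (by omega) rfl,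
        hookPosition_symm_apply (i := 0) (j := p - m + 1) _ (by omega) (by omega)]
      exact iff_of_true (t.row_lt _ _ _ _) hmp
    -- The row `m - p` is written as a successor to match `col_not_lt`: the word climbs the column,
    -- so the lower cell comes first.
    · rw [hookPosition_symm_apply (i := m - (p + 1) + 1) (j := 0) _ (by omega) (by omega),
        hookPosition_symm_apply (i := m - (p + 1)) (j := 0) _ rfl (by omega)]
      exact iff_of_false (t.col_not_lt _ _ _ _) hmp⟩
  invFun w :=
    { entry := (hookPosition k m hk).trans w.1
      row_lt := by
        intro i j h h'
        have h1 := mem_hookShape.1 h'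
        obtain rfl : i = 0 := by omega
        exact (w.2 (m + j) (by omega)).2 (by omega)
      col_not_lt := by
        intro i j h h'
        have h1 := mem_hookShape.1 h'
        obtain rfl : j = 0 := by omega
        have h2 := (w.2 (m - (i + 1)) (by omega)).not.2 (by omega)
        have h3 : hookPosition k m hk ⟨(i, 0), h⟩ = ⟨m - (i + 1) + 1, by omega⟩ := by
          refine Fin.ext ?_
          change m - i + 0 = _
          simp only
          omega
        rw [Equiv.trans_apply, Equiv.trans_apply, h3]
        exact h2 }
  left_inv t := by
    obtain ⟨e, h1, h2⟩ := t
    simp only [PTableau.mk.injEq]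
    ext c
    simp
  right_inv w := by
    refine Subtype.ext (Equiv.ext fun p => ?_)
    simp

/-- `hookFunctional` is evaluated on both sides of the expansion: it counts P-tableaux on X_G and is
the indicator of the hook on the Schur functions. -/
theorem hook_coeff_eq_card_pTableau (P : Type*) [PartialOrder P] [Fintype P]
    {c : YoungDiagram →₀ ℤ}
    (hc : IsSchurExpansion (chromaticSymmetricFunction (incomparabilityGraph P)) c) (k m : ℕ)
    (hk : 1 ≤ k) :
    c (hookShape k m hk) = (Nat.card (PTableau P (hookShape k m hk)) : ℤ) := by
  classical
  have hm : m < m + k := by omega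
  rw [Nat.card_congr (pTableauEquivHookWord P k m hk),
    ← hookFunctional_chromaticSymmetricFunction P hm, hc, Finsupp.sum, map_sum]
  have key : ∀ μ, hookFunctional (m + k) m (schurFunction μ) =
      Finsupp.single μ (1 : ℤ) (hookShape k m hk) := fun μ =>
    (hookFunctional_schurFunction μ hm).trans (card_hookWords_cells μ k m hk)
  simp_rw [map_zsmul, key]
  conv_lhs => rw [← Finsupp.sum_single c, Finsupp.sum, Finsupp.finsetSum_apply]
  refine Finset.sum_congr rfl fun μ _ => ?_
  rw [← Finsupp.smul_apply, Finsupp.smul_single, smul_eq_mul, mul_one]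

theorem mainTheorem3 (P : Type*) [PartialOrder P] [Fintype P] :
    (∃! c : YoungDiagram →₀ ℤ,
      IsSchurExpansion (chromaticSymmetricFunction (incomparabilityGraph P)) c) ∧
    ∀ c : YoungDiagram →₀ ℤ,
      IsSchurExpansion (chromaticSymmetricFunction (incomparabilityGraph P)) c →
      ∀ (k : ℕ) (hk : 1 ≤ k), k ≤ Fintype.card P →
        c (hookShape k (Fintype.card P - k) hk) =
          (Nat.card (PTableau P (hookShape k (Fintype.card P - k) hk)) : ℤ) :=
  ⟨existsUnique_isSchurExpansion _, fun _ hc k hk _ => hook_coeff_eq_card_pTableau P hc k _ hk⟩
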